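/- Let $a,b,c\in\mathbb R$ with ($c=0$ and $a\ne b$) or ($c>0$ and $a<b$), put $Q(x)=ax(x-1)+bx+c$, let $J_\nu$ be the Bessel function of the first kind of order $\nu$ and $$N_\nu(z)=az^2J_\nu''(z)+bzJ_\nu'(z)+cJ_\nu(z).$$ Let $\nu\ge 0$ be real, not smaller than any real root of $Q$ (that is, $\nu\ge\max\{0,\nu_0\}$ with $\nu_0$ the largest real root of $Q$, if there is one), and such that $Q(\nu)\ne0$. Consider the normalized functions $$f_\nu(z)=\Big[\tfrac{2^\nu\Gamma(\nu+1)}{Q(\nu)}N_\nu(z)\Big]^{1/\nu}\ (\nu\neq0),\qquad g_\nu(z)=\tfrac{2^\nu\Gamma(\nu+1)}{Q(\nu)}z^{1-\nu}N_\nu(z),\qquad h_\nu(z)=\tfrac{2^\nu\Gamma(\nu+1)}{Q(\nu)}z^{1-\nu/2}N_\nu(\sqrt z)$$ on the unit disk $\mathbb D$, with the branches that are holomorphic in $\mathbb D$ and have derivative $1$ at $0$. Let $\lambda_{\nu,1}$ be the smallest positive zero of $N_\nu$, and suppose that $1<\lambda_{\nu,1}$. Let $\varphi$ be a Ma–Minda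 function: holomorphic and univalent in $\mathbb D$, with $\operatorname{Re}\varphi>0$, $\varphi(0)=1$, $\varphi'(0)>0$, and $\varphi(\mathbb D)$ starlike with respect to $1$ and symmetric about the real axis. Let $\mathcal S^*(\varphi)$ be the class of holomorphic $f$ on $\mathbb D$ with $f(0)=0$, $f'(0)=1$ and $zf'(z)/f(z)\prec\varphi(z)$ (subordination in $\mathbb D$). Let $\beta$ be the radius of the largest disk $\{w:|w-1|<\beta\}$ contained in $\varphi(\mathbb D)$, and assume $\varphi(-1)=1-\beta$, where $\varphi(-1)$ is the radial limit $\lim_{t\to-1^+}\varphi(t)$. Then: 1. if $\nu\ne0$ and $1-\dfrac{N_\nu'(1)}{\nu N_\nu(1)}<\beta$, then $f_\nu$ is well defined on $\mathbb D$ and belongs to $\mathcal S^*(\varphi)$; 2. if $\nu-\dfrac{N_\nu'(1)}{N_\nu(1)}<\beta$, then $g_\nu$ belongs to $\mathcal S^*(\varphi)$; 3. if $\dfrac{\nu}{2}-\dfrac{N_\nu'(1)}{2N_\nu(1)}<\beta$, then $h_\nu$ belongs to $\mathcal S^*(\varphi)$. -/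

import Mathlib

open Set Filter Topology

/-- The Bessel function of the first kind of real order `ν`, with the principal branch of the
powers `(z / 2) ^ (2 n + ν)`; it is holomorphic on the plane slit along `(-∞, 0]`. -/
noncomputable def besselJ (ν : ℝ) (z : ℂ) : ℂ :=
  ∑' n : ℕ, (-1 : ℂ) ^ n / ((n.factorial : ℂ) * Complex.Gamma ((n : ℂ) + (ν : ℂ) + 1)) *
    (z / 2) ^ (2 * (n : ℂ) + (ν : ℂ))

/-- `N_ν(z) = a z² J_ν''(z) + b z J_ν'(z) + c J_ν(z)`, meant for `z` in the slit plane. -/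
noncomputable def besselN (a b c ν : ℝ) (z : ℂ) : ℂ :=
  (a : ℂ) * z ^ 2 * deriv (deriv (besselJ ν)) z + (b : ℂ) * z * deriv (besselJ ν) z +
    (c : ℂ) * besselJ ν z

/-- `Q(x) = a x (x - 1) + b x + c`. -/
def quadQ (a b c x : ℝ) : ℝ := a * x * (x - 1) + b * x + c

/-- The normalizing constant `2 ^ ν Γ(ν + 1) / Q(ν)`. -/
noncomputable def normConst (a b c ν : ℝ) : ℝ :=
  2 ^ ν * Real.Gamma (ν + 1) / quadQ a b c ν

/-- `F` is (on the unit disk) the function `f_ν = [2^ν Γ(ν+1) N_ν(z) / Q(ν)] ^ (1/ν)`, with the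
branch of the power normalized by `f_ν'(0) = 1`: if `2^ν Γ(ν+1) N_ν(z) / Q(ν) = z^ν e^{L(z)}` with
`L` holomorphic in the disk and `L(0) = 0`, then `f_ν(z) = z e^{L(z)/ν}`. As `L` is unique on the
disk, so is `F`. -/
def IsNormalizedF (a b c ν : ℝ) (F : ℂ → ℂ) : Prop :=
  ∃ L : ℂ → ℂ, DifferentiableOn ℂ L (Metric.ball 0 1) ∧ L 0 = 0 ∧
    (∀ z ∈ Metric.ball (0 : ℂ) 1 ∩ Complex.slitPlane,
      (normConst a b c ν : ℂ) * besselN a b c ν z = z ^ (ν : ℂ) * Complex.exp (L z)) ∧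
    ∀ z ∈ Metric.ball (0 : ℂ) 1, F z = z * Complex.exp (L z / (ν : ℂ))

/-- `g_ν(z) = 2^ν Γ(ν+1) z^(1-ν) N_ν(z) / Q(ν)`, given by this formula on the slit plane and
extended by limits to `(-∞, 0]`. -/
noncomputable def normalizedG (a b c ν : ℝ) : ℂ → ℂ :=
  extendFrom Complex.slitPlane fun z =>
    (normConst a b c ν : ℂ) * z ^ (1 - (ν : ℂ)) * besselN a b c ν z

/-- `h_ν(z) = 2^ν Γ(ν+1) z^(1-ν/2) N_ν(√z) / Q(ν)`, given by this formula on the slit plane and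
extended by limits to `(-∞, 0]`. -/
noncomputable def normalizedH (a b c ν : ℝ) : ℂ → ℂ :=
  extendFrom Complex.slitPlane fun z =>
    (normConst a b c ν : ℂ) * z ^ (1 - (ν : ℂ) / 2) * besselN a b c ν (z ^ (1 / 2 : ℂ))

/-- The class `𝒜`: holomorphic in the unit disk with `f(0) = 0` and `f'(0) = 1`. -/
def IsClassA (f : ℂ → ℂ) : Prop :=
  DifferentiableOn ℂ f (Metric.ball 0 1) ∧ f 0 = 0 ∧ deriv f 0 = 1

/-- Ma–Minda functions on the unit disk. -/
structure IsMaMinda (φ : ℂ → ℂ) : Prop where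
  holomorphic : DifferentiableOn ℂ φ (Metric.ball 0 1)
  univalent : InjOn φ (Metric.ball 0 1)
  re_pos : ∀ z ∈ Metric.ball (0 : ℂ) 1, 0 < (φ z).re
  map_zero : φ 0 = 1
  deriv_zero_im : (deriv φ 0).im = 0
  deriv_zero_pos : 0 < (deriv φ 0).re
  starlike : StarConvex ℝ (1 : ℂ) (φ '' Metric.ball 0 1)
  symmetric : ∀ w ∈ φ '' Metric.ball 0 1, (starRingEnd ℂ) w ∈ φ '' Metric.ball 0 1

/-- Subordination `F ≺ G` in the unit disk. -/
def Subordinate (F G : ℂ → ℂ) : Prop :=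
  DifferentiableOn ℂ F (Metric.ball 0 1) ∧
    ∃ ω : ℂ → ℂ, DifferentiableOn ℂ ω (Metric.ball 0 1) ∧
      MapsTo ω (Metric.ball 0 1) (Metric.ball 0 1) ∧ ω 0 = 0 ∧
      ∀ z ∈ Metric.ball (0 : ℂ) 1, F z = G (ω z)

open Classical in
/-- `z f'(z) / f(z)`, with its limit `1` at the origin (for `f` in the class `𝒜`). -/
noncomputable def starQuotient (f : ℂ → ℂ) (z : ℂ) : ℂ :=
  if z = 0 then 1 else z * deriv f z / f z

/-- The class `𝒮*(φ)`: `f ∈ 𝒜` without zeros in the punctured disk such that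
`z f'(z) / f(z) ≺ φ(z)`. -/
def IsMaMindaStarlike (φ f : ℂ → ℂ) : Prop :=
  IsClassA f ∧ (∀ z ∈ Metric.ball (0 : ℂ) 1, z ≠ 0 → f z ≠ 0) ∧
    Subordinate (starQuotient f) φ

/-! Write `θ = z d/dz`. Then `N_ν = Q(θ) J_ν`, and `J_ν` is, up to a constant, `z ^ ν Λ(z²)` with
`Λ` entire (`besselEntire`). On functions `z ^ ν F(z²)` the operator `θ` acts as `ν + 2 D`, where `D
= w d/dw` in the variable `w = z²`. Hence the normalized `N_ν` is `z ^ ν W(z²)` with `W = Q(ν + 2 D)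
Λ / Q(ν)`, and each of `f_ν`, `g_ν`, `h_ν` is `z` times a nonvanishing function whose logarithmic
derivative comes from that of `W`.

The heart is that `W` is a locally uniform limit of polynomials with only positive roots. Such
polynomials are preserved by `p ↦ p + B X p' - A X p` with `A, B ≥ 0` (`PosRooted.eulerOp`).
Applying the operators with `A = 0` and `B = 1 / (ν + 1 + m)`, `m < N`, to `(1 - X / (4 N²)) ^ N`
gives polynomials that tend to `Λ`. One or two further operators lead from `Λ` to `W`: one if `Λ''`
is eliminated by Bessel's equation, two if `Q` is split into real linear factors
(`posRootedLimit_besselNEntire`).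

If all roots `r` of `p` exceed `1`, then `p' / p` is a sum of terms `1 / (w - r)`, each of modulus
at most `1 / (r - 1)` on the closed disk, with equality at `w = 1`. This bound survives the limit
(`PosRootedLimit.norm_logDeriv_le`): `|W' / W| ≤ M = -Re (W'(1) / W(1))` there. So `z f' / f` stays
within `2 M / ν`, `2 M` or `M` of `1` for `f_ν`, `g_ν`, `h_ν`. As `N_ν'(1) / N_ν(1)` has real part
`ν - 2 M`, the hypotheses say that these numbers are less than `β`. The quotient thus takes values
in `φ(𝔻)`, and composing with the holomorphic inverse of `φ` gives the subordination
(`IsMaMinda.isMaMindaStarlike`). -/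

/-! ### Polynomials with positive roots and the Euler operators. -/

open Polynomial in
/-- A complex polynomial with constant term `1` all of whose roots are positive real numbers. -/
def PosRooted (p : ℂ[X]) : Prop :=
  p.eval 0 = 1 ∧ ∀ w : ℂ, p.eval w = 0 → ∃ r : ℝ, 0 < r ∧ w = r

open Polynomial in
/-- The operator `p ↦ p + B X p' - A X p`. -/
noncomputable def eulerOp (A B : ℝ) (p : ℂ[X]) : ℂ[X] :=
  p + C (B : ℂ) * X * derivative p - C (A : ℂ) * X * p

lemma PosRooted.ne_zero {p : Polynomial ℂ} (hp : PosRooted p) : p ≠ 0 := by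
  rintro rfl
  simpa using hp.1

lemma PosRooted.exists_of_mem_roots {p : Polynomial ℂ} (hp : PosRooted p) {w : ℂ}
    (hw : w ∈ p.roots) : ∃ r : ℝ, 0 < r ∧ w = r :=
  hp.2 w (Polynomial.isRoot_of_mem_roots hw)

/-- Here `T` is the sum of `r / |w - r|²`, whose terms are positive, so `T = 0` only for the empty
multiset. This is the sign of `Im (w p'(w) / p(w))`. -/
lemma im_sum_div_sub (w : ℂ) (s : Multiset ℂ)
    (hs : ∀ z ∈ s, w ≠ z ∧ ∃ r : ℝ, 0 < r ∧ z = r) :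
    ∃ T : ℝ, 0 ≤ T ∧ (s.map fun z => w / (w - z)).sum.im = -(T * w.im) ∧
      (T = 0 → (s.map fun z => w / (w - z)).sum = 0) := by
  induction s using Multiset.induction with
  | empty => exact ⟨0, by simp⟩
  | cons a s ih =>
    obtain ⟨T, hT, him, -⟩ := ih fun z hz => hs z (Multiset.mem_cons_of_mem hz)
    obtain ⟨hwa, r, hr, rfl⟩ := hs a (Multiset.mem_cons_self a s)
    have hpos : 0 < Complex.normSq (w - r) := Complex.normSq_pos.2 (sub_ne_zero.2 hwa)
    have hd : 0 < r / Complex.normSq (w - r) := div_pos hr hpos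
    refine ⟨r / Complex.normSq (w - r) + T, by positivity, ?_, fun h => by linarith⟩
    rw [Multiset.map_cons, Multiset.sum_cons, Complex.add_im, him, Complex.div_im]
    simp only [Complex.sub_re, Complex.sub_im, Complex.ofReal_re, Complex.ofReal_im]
    ring

lemma re_sum_div_sub_nonneg {x : ℝ} (hx : x ≤ 0) (s : Multiset ℂ)
    (hs : ∀ z ∈ s, ∃ r : ℝ, 0 < r ∧ z = r) :
    0 ≤ (s.map fun z => (x : ℂ) / (x - z)).sum.re := by
  induction s using Multiset.induction with
  | empty => simp
  | cons a s ih =>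
    obtain ⟨r, hr, rfl⟩ := hs a (Multiset.mem_cons_self a s)
    have h := ih fun z hz => hs z (Multiset.mem_cons_of_mem hz)
    rw [Multiset.map_cons, Multiset.sum_cons, Complex.add_re]
    have : ((x : ℂ) / (x - r)) = ((x / (x - r) : ℝ) : ℂ) := by push_cast; rfl
    rw [this, Complex.ofReal_re]
    have := div_nonneg_of_nonpos hx (by linarith : x - r ≤ 0)
    linarith

/-- A new root `w` satisfies `1 + B S - A w = 0` with `S = w p'(w) / p(w) = ∑ w / (w - r)`. Off the
real axis both `B S` and `-A w` have imaginary part of the sign of `-Im w`, and on `(-∞, 0]` both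
have nonnegative real part, so neither can occur. -/
lemma PosRooted.eulerOp {p : Polynomial ℂ} (hp : PosRooted p) {A B : ℝ} (hA : 0 ≤ A)
    (hB : 0 ≤ B) : PosRooted (eulerOp A B p) := by
  refine ⟨by simp [_root_.eulerOp, hp.1], fun w hw => ?_⟩
  by_cases hpw : p.eval w = 0
  · exact hp.2 w hpw
  have hsum := (IsAlgClosed.splits p).eval_derivative_eq_eval_mul_sum hpw
  have hS : w * (p.roots.map fun z => 1 / (w - z)).sum =
      (p.roots.map fun z => w / (w - z)).sum := by
    rw [← Multiset.sum_map_mul_left]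
    simp [div_eq_mul_inv]
  have hroots : ∀ z ∈ p.roots, w ≠ z ∧ ∃ r : ℝ, 0 < r ∧ z = r := fun z hz =>
    ⟨fun h => hpw (h ▸ Polynomial.isRoot_of_mem_roots hz), hp.exists_of_mem_roots hz⟩
  obtain ⟨T, hT, him, hT0⟩ := im_sum_div_sub w p.roots hroots
  set S := (p.roots.map fun z => w / (w - z)).sum with hSdef
  have key : 1 + (B : ℂ) * S - A * w = 0 := by
    have : p.eval w * (1 + (B : ℂ) * S - A * w) = 0 := by
      simp only [_root_.eulerOp, Polynomial.eval_sub, Polynomial.eval_add, Polynomial.eval_mul,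
        Polynomial.eval_C, Polynomial.eval_X, hsum] at hw
      rw [← hw, ← hS]
      ring
    exact (mul_eq_zero.1 this).resolve_left hpw
  have kre := congrArg Complex.re key
  have kim := congrArg Complex.im key
  simp only [Complex.sub_re, Complex.add_re, Complex.one_re, Complex.re_ofReal_mul,
    Complex.zero_re, Complex.sub_im, Complex.add_im, Complex.one_im, Complex.im_ofReal_mul,
    Complex.zero_im, him] at kre kim
  by_cases hwim : w.im = 0
  · have hw' : w = (w.re : ℂ) := Complex.ext (by simp) (by simp [hwim])
    refine ⟨w.re, ?_, hw'⟩
    by_contra! hle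
    have h := re_sum_div_sub_nonneg hle p.roots fun z hz => (hroots z hz).2
    rw [← hw'] at h
    nlinarith [mul_nonneg hB h, mul_nonneg hA (neg_nonneg.2 hle)]
  -- The imaginary part forces `A = 0` and `B T = 0`. Then `B S = 0`, and the equation reads `1 =
  -- 0`.
  · exfalso
    have h0 : (A + B * T) * w.im = 0 := by linarith
    have h1 : A + B * T = 0 := (mul_eq_zero.1 h0).resolve_right hwim
    have hBT := mul_nonneg hB hT
    have hA0 : A = 0 := by linarith
    have hBT0 : B * T = 0 := by linarith
    rw [hA0] at kre
    rcases mul_eq_zero.1 hBT0 with h | h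
    · rw [h] at kre; linarith
    · rw [hT0 h] at kre; simp at kre

/-! ### Estimates in the disk for polynomials with roots beyond `1`. -/

/-- Termwise, `|w - r| ≥ r - 1`, and the terms at `w = 1` are `-1 / (r - 1)`, all of one sign, so
that no cancellation occurs there. -/
lemma norm_sum_one_div_sub_le {w : ℂ} (hw : ‖w‖ ≤ 1) (s : Multiset ℂ)
    (hs : ∀ z ∈ s, ∃ r : ℝ, 1 < r ∧ z = r) :
    ‖(s.map fun z => 1 / (w - z)).sum‖ ≤ -(s.map fun z => 1 / (1 - z)).sum.re := by
  induction s using Multiset.induction with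
  | empty => simp
  | cons a s ih =>
    obtain ⟨r, hr, rfl⟩ := hs a (Multiset.mem_cons_self a s)
    have h := ih fun z hz => hs z (Multiset.mem_cons_of_mem hz)
    rw [Multiset.map_cons, Multiset.sum_cons, Multiset.map_cons, Multiset.sum_cons,
      Complex.add_re]
    have h1 : (1 / (1 - (r : ℂ))) = ((1 / (1 - r) : ℝ) : ℂ) := by push_cast; rfl
    have h2 : r - 1 ≤ ‖w - r‖ := by
      have := norm_sub_norm_le (r : ℂ) w
      rw [norm_sub_rev, Complex.norm_of_nonneg (by linarith)] at this
      linarith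
    have h3 : ‖1 / (w - (r : ℂ))‖ ≤ 1 / (r - 1) := by
      rw [norm_div, norm_one]
      exact one_div_le_one_div_of_le (by linarith) h2
    have h4 : 1 / (1 - r) = -(1 / (r - 1)) := by rw [← neg_sub, one_div_neg_eq_neg_one_div]
    rw [h1, Complex.ofReal_re, h4]
    refine (norm_add_le _ _).trans ?_
    linarith

lemma PosRooted.one_lt_of_mem_roots {p : Polynomial ℂ} (hp : PosRooted p)
    (h1 : ∀ t ∈ Icc (0 : ℝ) 1, p.eval (t : ℂ) ≠ 0) {z : ℂ} (hz : z ∈ p.roots) :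
    ∃ r : ℝ, 1 < r ∧ z = r := by
  obtain ⟨r, hr, rfl⟩ := hp.exists_of_mem_roots hz
  refine ⟨r, ?_, rfl⟩
  by_contra! hle
  exact h1 r ⟨hr.le, hle⟩ (Polynomial.isRoot_of_mem_roots hz)

/-- Each linear factor satisfies `|w - r| ≥ r - |w|`. Being a closed inequality, this passes to
limits and carries zero-freeness from `[0, 1]` to the disk without Hurwitz's theorem. -/
lemma PosRooted.norm_eval_norm_le {p : Polynomial ℂ} (hp : PosRooted p)
    (h1 : ∀ t ∈ Icc (0 : ℝ) 1, p.eval (t : ℂ) ≠ 0) {w : ℂ} (hw : ‖w‖ ≤ 1) :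
    ‖p.eval (‖w‖ : ℂ)‖ ≤ ‖p.eval w‖ := by
  have key : ∀ x : ℂ, ‖p.eval x‖ =
      ‖p.leadingCoeff‖ * (p.roots.map fun z => ‖x - z‖).prod := by
    intro x
    rw [(IsAlgClosed.splits p).eval_eq_prod_roots, norm_mul]
    congr 1
    induction p.roots using Multiset.induction with
    | empty => simp
    | cons a s ih => simp [ih]
  rw [key, key]
  refine mul_le_mul_of_nonneg_left ?_ (norm_nonneg _)
  refine Multiset.prod_map_le_prod_map₀ _ _ (fun z _ => norm_nonneg _) fun z hz => ?_
  obtain ⟨r, hr, rfl⟩ := hp.one_lt_of_mem_roots h1 hz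
  have := norm_sub_norm_le (r : ℂ) w
  rw [norm_sub_rev (r : ℂ), Complex.norm_of_nonneg (by linarith)] at this
  rw [norm_sub_rev, ← Complex.ofReal_sub, Complex.norm_of_nonneg (by linarith)]
  exact this

lemma PosRooted.norm_derivative_div_le {p : Polynomial ℂ} (hp : PosRooted p)
    (h1 : ∀ t ∈ Icc (0 : ℝ) 1, p.eval (t : ℂ) ≠ 0) {w : ℂ} (hw : ‖w‖ ≤ 1) :
    ‖p.derivative.eval w / p.eval w‖ ≤ -(p.derivative.eval 1 / p.eval 1).re := by
  have hpos := norm_pos_iff.2 (h1 ‖w‖ ⟨norm_nonneg _, hw⟩)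
  have hw0 : p.eval w ≠ 0 := norm_pos_iff.1 (hpos.trans_le (hp.norm_eval_norm_le h1 hw))
  have h10 : p.eval 1 ≠ 0 := by simpa using h1 1 ⟨zero_le_one, le_rfl⟩
  rw [(IsAlgClosed.splits p).eval_derivative_div_eval_of_ne_zero hw0,
    (IsAlgClosed.splits p).eval_derivative_div_eval_of_ne_zero h10]
  exact norm_sum_one_div_sub_le hw _ fun z hz => hp.one_lt_of_mem_roots h1 hz

/-! ### Limits of polynomials with positive roots. -/

/-- Locally uniform limits on the plane of polynomials in the class `PosRooted`. -/
def PosRootedLimit (W : ℂ → ℂ) : Prop :=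
  ∃ P : ℕ → Polynomial ℂ, (∀ N, PosRooted (P N)) ∧
    TendstoLocallyUniformlyOn (fun N w => (P N).eval w) W atTop univ

namespace PosRootedLimit

variable {W : ℂ → ℂ}

lemma differentiable (hW : PosRootedLimit W) : Differentiable ℂ W := by
  obtain ⟨P, -, hP⟩ := hW
  exact differentiableOn_univ.1 (hP.differentiableOn
    (Eventually.of_forall fun N => (P N).differentiable.differentiableOn) isOpen_univ)

lemma tendsto_derivative {P : ℕ → Polynomial ℂ}
    (hP : TendstoLocallyUniformlyOn (fun N w => (P N).eval w) W atTop univ) :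
    TendstoLocallyUniformlyOn (fun N w => (P N).derivative.eval w) (deriv W) atTop univ := by
  have := hP.deriv (Eventually.of_forall fun N => (P N).differentiable.differentiableOn)
    isOpen_univ
  refine this.congr fun N w _ => ?_
  simp

lemma map_zero (hW : PosRootedLimit W) : W 0 = 1 := by
  obtain ⟨P, hpos, hP⟩ := hW
  refine tendsto_nhds_unique (hP.tendsto_at (mem_univ 0)) ?_
  simp [(hpos _).1]

lemma euler (hW : PosRootedLimit W) {A B : ℝ} (hA : 0 ≤ A) (hB : 0 ≤ B) :
    PosRootedLimit fun w => W w + B * w * deriv W w - A * w * W w := by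
  have hd := hW.differentiable
  obtain ⟨P, hpos, hP⟩ := hW
  refine ⟨fun N => eulerOp A B (P N), fun N => (hpos N).eulerOp hA hB, ?_⟩
  have hid : ∀ C : ℝ, TendstoLocallyUniformlyOn (fun (_ : ℕ) (w : ℂ) => (C : ℂ) * w)
      (fun w => (C : ℂ) * w) atTop univ := fun C =>
    TendstoUniformlyOn.tendstoLocallyUniformlyOn (by
      intro u hu
      exact Eventually.of_forall fun n x _ => refl_mem_uniformity hu)
  have h1 := (hid B).mul₀ (tendsto_derivative hP) (by fun_prop)
    (hd.contDiff (n := 1)).continuous_deriv_one.continuousOn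
  have h2 := (hid A).mul₀ hP (by fun_prop) hd.continuous.continuousOn
  refine ((hP.add h1).sub h2).congr fun N w _ => ?_
  simp [eulerOp]

/-- By compactness `|W|` has a positive minimum on `[0, 1]`, and eventually the polynomials are
closer to `W` than that minimum. -/
lemma eventually_ne_zero {P : ℕ → Polynomial ℂ} (hd : Continuous W)
    (hP : TendstoLocallyUniformlyOn (fun N w => (P N).eval w) W atTop univ)
    (h1 : ∀ t ∈ Icc (0 : ℝ) 1, W t ≠ 0) :
    ∀ᶠ N in atTop, ∀ t ∈ Icc (0 : ℝ) 1, (P N).eval (t : ℂ) ≠ 0 := by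
  have hK : IsCompact ((fun t : ℝ => (t : ℂ)) '' Icc (0 : ℝ) 1) :=
    isCompact_Icc.image Complex.continuous_ofReal
  have hU := (tendstoLocallyUniformlyOn_iff_forall_isCompact isOpen_univ).1 hP _
    (subset_univ _) hK
  obtain ⟨_, ⟨t₀, ht₀, rfl⟩, hmin⟩ := hK.exists_isMinOn
    ⟨((0 : ℝ) : ℂ), mem_image_of_mem _ (by simp)⟩ (f := fun w => ‖W w‖) (by fun_prop)
  have hpos : 0 < ‖W t₀‖ := norm_pos_iff.2 (h1 t₀ ht₀)
  filter_upwards [Metric.tendstoUniformlyOn_iff.1 hU _ hpos] with N hN t ht h0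
  have h2 := hN _ (mem_image_of_mem _ ht)
  have h3 : ‖W t₀‖ ≤ ‖W t‖ := hmin (mem_image_of_mem (fun t : ℝ => (t : ℂ)) ht)
  simp only [h0, dist_zero_right] at h2
  linarith

/-- If `W` has no zeros on `[0, 1]`, it has none in the closed unit disk, and there its logarithmic
derivative is dominated by the value at `1`. -/
theorem norm_logDeriv_le (hW : PosRootedLimit W) (h1 : ∀ t ∈ Icc (0 : ℝ) 1, W t ≠ 0) {w : ℂ}
    (hw : ‖w‖ ≤ 1) : W w ≠ 0 ∧ ‖deriv W w / W w‖ ≤ -(deriv W 1 / W 1).re := by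
  have hd := hW.differentiable
  obtain ⟨P, hpos, hP⟩ := hW
  have hev := eventually_ne_zero hd.continuous hP h1
  have ht : ∀ z, Tendsto (fun N => (P N).eval z) atTop (𝓝 (W z)) :=
    fun z => hP.tendsto_at (mem_univ z)
  have ht' : ∀ z, Tendsto (fun N => (P N).derivative.eval z) atTop (𝓝 (deriv W z)) :=
    fun z => (tendsto_derivative hP).tendsto_at (mem_univ z)
  have hle : ‖W ‖w‖‖ ≤ ‖W w‖ := le_of_tendsto_of_tendsto (ht _).norm (ht _).norm
    (hev.mono fun N hN => (hpos N).norm_eval_norm_le hN hw)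
  have hw0 : W w ≠ 0 :=
    norm_pos_iff.1 ((norm_pos_iff.2 (h1 ‖w‖ ⟨norm_nonneg _, hw⟩)).trans_le hle)
  have h10 : W 1 ≠ 0 := by simpa using h1 1 ⟨zero_le_one, le_rfl⟩
  refine ⟨hw0, le_of_tendsto_of_tendsto ((ht' w).div (ht w) hw0).norm
    ((Complex.continuous_re.tendsto _).comp ((ht' 1).div (ht 1) h10)).neg
    (hev.mono fun N hN => (hpos N).norm_derivative_div_le hN hw)⟩

end PosRootedLimit

/-! ### Polynomial approximation of the normalized Bessel function. -/

lemma prod_one_add_div_succ {x : ℝ} (hx : 0 < x) (N n : ℕ) :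
    ∏ k ∈ Finset.range n, (1 + ((N + 1 : ℕ) : ℝ) / (x + k)) =
      (∏ k ∈ Finset.range n, (1 + (N : ℝ) / (x + k))) * (1 + (n : ℝ) / (x + N)) := by
  induction n with
  | zero => simp
  | succ n ih =>
    have h1 : x + n ≠ 0 := by positivity
    have h2 : x + N ≠ 0 := by positivity
    rw [Finset.prod_range_succ, ih, Finset.prod_range_succ, mul_assoc, mul_assoc]
    congr 1
    push_cast
    field_simp
    ring

/-- Both sides equal `Γ(x) Γ(x + N + n) / (Γ(x + N) Γ(x + n))`. The exchange turns the `N` factors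
in the `n`-th coefficient of the approximation into `n` factors, a number that stays fixed as `N →
∞`. -/
lemma prod_one_add_div_comm {x : ℝ} (hx : 0 < x) (N n : ℕ) :
    ∏ j ∈ Finset.range N, (1 + (n : ℝ) / (x + j)) =
      ∏ k ∈ Finset.range n, (1 + (N : ℝ) / (x + k)) := by
  induction N with
  | zero => simp
  | succ N ih => rw [prod_one_add_div_succ hx, Finset.prod_range_succ, ih]

lemma coeff_eulerOp_zero (B : ℝ) (p : Polynomial ℂ) (n : ℕ) :
    (eulerOp 0 B p).coeff n = (1 + B * n) * p.coeff n := by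
  cases n with
  | zero => simp [eulerOp, mul_assoc]
  | succ n =>
    simp only [eulerOp, mul_assoc, Polynomial.coeff_sub, Polynomial.coeff_add,
      Polynomial.coeff_C_mul, Polynomial.coeff_X_mul, Polynomial.coeff_derivative]
    push_cast
    ring

/-- Hypergeometric (Jacobi) polynomials approximating `Γ(ν + 1) (2 / √w) ^ ν J_ν(√w)`. -/
noncomputable def besselApprox (ν : ℝ) (N : ℕ) : ℕ → Polynomial ℂ
  | 0 => (1 + Polynomial.C (-1 / (4 * N ^ 2) : ℂ) * Polynomial.X) ^ N
  | m + 1 => eulerOp 0 (1 / (ν + 1 + m)) (besselApprox ν N m)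

lemma posRooted_besselApprox {ν : ℝ} (hν : 0 ≤ ν) (N m : ℕ) :
    PosRooted (besselApprox ν N m) := by
  induction m with
  | succ m ih => exact ih.eulerOp le_rfl (by positivity)
  | zero =>
    refine ⟨by simp [besselApprox], fun w hw => ?_⟩
    -- For `N = 0` the polynomial is the constant `1` and has no roots; otherwise the only root is
    -- `4 N²`.
    rcases Nat.eq_zero_or_pos N with rfl | hN
    · simp [besselApprox] at hw
    · refine ⟨4 * N ^ 2, by positivity, ?_⟩
      have hN' : (N : ℂ) ≠ 0 := by exact_mod_cast hN.ne'
      simp only [besselApprox, Polynomial.eval_pow, Polynomial.eval_add, Polynomial.eval_one,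
        Polynomial.eval_mul, Polynomial.eval_C, Polynomial.eval_X] at hw
      have := pow_eq_zero_iff hN.ne' |>.1 hw
      field_simp at this
      push_cast
      linear_combination -this

lemma coeff_one_add_C_mul_X_pow (c : ℂ) (N n : ℕ) :
    ((1 + Polynomial.C c * Polynomial.X) ^ N).coeff n = N.choose n * c ^ n := by
  have : (1 + Polynomial.C c * Polynomial.X) ^ N =
      ((1 + Polynomial.X) ^ N : Polynomial ℂ).comp (Polynomial.C c * Polynomial.X) := by simp
  rw [this, Polynomial.comp_C_mul_X_coeff, Polynomial.coeff_one_add_X_pow]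

lemma coeff_besselApprox (ν : ℝ) (N m n : ℕ) :
    (besselApprox ν N m).coeff n =
      ((N.choose n * (-1 / (4 * N ^ 2)) ^ n *
        ∏ j ∈ Finset.range m, (1 + (n : ℝ) / (ν + 1 + j)) : ℝ) : ℂ) := by
  induction m with
  | zero => simp [besselApprox, coeff_one_add_C_mul_X_pow]
  | succ m ih =>
    rw [besselApprox, coeff_eulerOp_zero, ih, Finset.prod_range_succ]
    push_cast
    ring

/-- The Taylor coefficients of `Γ(ν + 1) (2 / √w) ^ ν J_ν(√w)`. -/
noncomputable def besselCoeff (ν : ℝ) (n : ℕ) : ℝ :=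
  (-1 / 4) ^ n / (n.factorial * ∏ k ∈ Finset.range n, (ν + 1 + k))

/-- The entire function `Γ(ν + 1) (2 / √w) ^ ν J_ν(√w)`. -/
noncomputable def besselEntire (ν : ℝ) (w : ℂ) : ℂ :=
  ∑' n, (besselCoeff ν n : ℂ) * w ^ n

lemma coeff_besselApprox_diag {ν : ℝ} (hν : 0 ≤ ν) {N : ℕ} (hN : 0 < N) (n : ℕ) :
    (besselApprox ν N N).coeff n =
      (((N.choose n / N ^ n) * (-1 / 4) ^ n *
        ∏ k ∈ Finset.range n, (1 / (N : ℝ) + 1 / (ν + 1 + k)) : ℝ) : ℂ) := by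
  rw [coeff_besselApprox, prod_one_add_div_comm (by positivity)]
  congr 1
  have hN' : (N : ℝ) ≠ 0 := by positivity
  have : ∏ k ∈ Finset.range n, (1 + (N : ℝ) / (ν + 1 + k)) =
      N ^ n * ∏ k ∈ Finset.range n, (1 / (N : ℝ) + 1 / (ν + 1 + k)) := by
    rw [← Finset.card_range n, ← Finset.prod_const, Finset.card_range, ← Finset.prod_mul_distrib]
    refine Finset.prod_congr rfl fun k _ => ?_
    field_simp
  rw [this, div_pow, div_pow, mul_pow, ← pow_mul, mul_comm 2 n, pow_mul]
  field_simp

lemma tendsto_choose_div_pow (n : ℕ) :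
    Tendsto (fun N : ℕ => (N.choose n : ℝ) / N ^ n) atTop (𝓝 (1 / n.factorial)) := by
  induction n with
  | zero => simp
  | succ n ih =>
    have h : Tendsto (fun N : ℕ => ((N.choose n : ℝ) / N ^ n) * ((1 - n / N) / (n + 1)))
        atTop (𝓝 (1 / n.factorial * ((1 - 0) / (n + 1)))) :=
      ih.mul ((tendsto_const_nhds.sub (tendsto_const_div_atTop_nhds_zero_nat _)).div_const _)
    have he : 1 / (n.factorial : ℝ) * ((1 - 0) / (n + 1)) = 1 / (n + 1).factorial := by
      rw [Nat.factorial_succ]; push_cast; field_simp; ring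
    rw [he] at h
    refine h.congr' ?_
    filter_upwards [eventually_ge_atTop (n + 1)] with N hN
    have h0 : (N : ℝ) ≠ 0 := by have : 0 < N := by lia
                                positivity
    have h1 : ((N.choose (n + 1) : ℕ) : ℝ) * (n + 1) = N.choose n * (N - n) := by
      have := Nat.choose_succ_right_eq N n
      rw [← Nat.cast_sub (by lia : n ≤ N)]
      exact_mod_cast this
    rw [pow_succ]
    field_simp
    linear_combination -h1

lemma tendsto_coeff_besselApprox {ν : ℝ} (hν : 0 ≤ ν) (n : ℕ) :
    Tendsto (fun N => (besselApprox ν N N).coeff n) atTop (𝓝 (besselCoeff ν n : ℂ)) := by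
  have h : Tendsto (fun N : ℕ => ((N.choose n / N ^ n) * (-1 / 4) ^ n *
        ∏ k ∈ Finset.range n, (1 / (N : ℝ) + 1 / (ν + 1 + k)) : ℝ)) atTop
      (𝓝 (1 / n.factorial * (-1 / 4) ^ n * ∏ k ∈ Finset.range n, (0 + 1 / (ν + 1 + k)))) :=
    ((tendsto_choose_div_pow n).mul_const _).mul (tendsto_finsetProd _ fun k _ =>
      (tendsto_const_div_atTop_nhds_zero_nat 1).add_const _)
  have he : 1 / (n.factorial : ℝ) * (-1 / 4) ^ n *
      ∏ k ∈ Finset.range n, (0 + 1 / (ν + 1 + k)) = besselCoeff ν n := by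
    simp only [zero_add, one_div, Finset.prod_inv_distrib, besselCoeff]
    field_simp
  rw [he] at h
  refine (Complex.continuous_ofReal.tendsto _ |>.comp h).congr' ?_
  filter_upwards [eventually_gt_atTop 0] with N hN
  rw [coeff_besselApprox_diag hν hN]
  rfl

/-- The `n` factors of the product are at most `2`, which `(1 / 4) ^ n` absorbs. Uniformity in `N`
gives the majorant for dominated convergence. -/
lemma norm_coeff_besselApprox_le {ν : ℝ} (hν : 0 ≤ ν) {N : ℕ} (hN : 0 < N) (n : ℕ) :
    ‖(besselApprox ν N N).coeff n‖ ≤ 1 / n.factorial := by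
  rw [coeff_besselApprox_diag hν hN, Complex.norm_real, norm_mul, norm_mul, norm_pow,
    Real.norm_of_nonneg (by positivity : 0 ≤ (N.choose n : ℝ) / N ^ n),
    Real.norm_of_nonneg (Finset.prod_nonneg fun k _ => by positivity)]
  have h1 : (N.choose n : ℝ) / N ^ n ≤ 1 / n.factorial := by
    have := Nat.choose_le_pow_div (α := ℝ) n N
    rw [div_le_iff₀ (by positivity)]
    linarith [this, (by ring : (1 : ℝ) / n.factorial * N ^ n = N ^ n / n.factorial)]
  have h2 : ∏ k ∈ Finset.range n, (1 / (N : ℝ) + 1 / (ν + 1 + k)) ≤ 2 ^ n := by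
    rw [← Finset.card_range n, ← Finset.prod_const, Finset.card_range]
    refine Finset.prod_le_prod (fun k _ => by positivity) fun k _ => ?_
    have hN1 : (1 : ℝ) ≤ N := by exact_mod_cast hN
    have h3 : 1 / (N : ℝ) ≤ 1 := by rw [div_le_one (by positivity)]; exact hN1
    have h4 : 1 / (ν + 1 + k) ≤ 1 := by
      rw [div_le_one (by positivity)]
      linarith [(Nat.cast_nonneg k : (0 : ℝ) ≤ k)]
    linarith
  calc _ ≤ 1 / (n.factorial : ℝ) * (1 / 4) ^ n * 2 ^ n := by
        have : ‖(-1 / 4 : ℝ)‖ = 1 / 4 := by norm_num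
        rw [this]
        gcongr
    _ = 1 / (n.factorial : ℝ) * (1 / 2) ^ n := by
        rw [mul_assoc, ← mul_pow]; norm_num
    _ ≤ 1 / (n.factorial : ℝ) * 1 := by
        gcongr
        exact pow_le_one₀ (by norm_num) (by norm_num)
    _ = _ := mul_one _

lemma summable_pow_div_factorial (R : ℝ) :
    Summable fun n : ℕ => 1 / (n.factorial : ℝ) * R ^ n := by
  simpa [div_eq_mul_inv, mul_comm] using Real.summable_pow_div_factorial R

lemma eval_eq_tsum (p : Polynomial ℂ) (w : ℂ) : p.eval w = ∑' n, p.coeff n * w ^ n := by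
  rw [Polynomial.eval_eq_sum_range, tsum_eq_sum]
  intro n hn
  rw [Polynomial.coeff_eq_zero_of_natDegree_lt (by simpa using hn), zero_mul]

/-- Polynomials with coefficients bounded by `1 / n!` converge locally uniformly if their
coefficients converge. -/
lemma tendstoLocallyUniformlyOn_of_coeff {P : ℕ → Polynomial ℂ} {d : ℕ → ℂ}
    (hb : ∀ᶠ N in atTop, ∀ n, ‖(P N).coeff n‖ ≤ 1 / n.factorial)
    (hd : ∀ n, Tendsto (fun N => (P N).coeff n) atTop (𝓝 (d n))) :
    TendstoLocallyUniformlyOn (fun N w => (P N).eval w) (fun w => ∑' n, d n * w ^ n)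
      atTop univ := by
  have hdb : ∀ n, ‖d n‖ ≤ 1 / n.factorial := fun n =>
    le_of_tendsto (hd n).norm (hb.mono fun N h => h n)
  rw [tendstoLocallyUniformlyOn_iff_forall_isCompact isOpen_univ]
  intro K _ hK
  obtain ⟨R, hR⟩ := hK.isBounded.exists_norm_le
  -- This sum bounds the error uniformly on the disk of radius `|R|`; it tends to `0` by dominated
  -- convergence with majorant `2 |R| ^ n / n!`.
  have hlim : Tendsto (fun N => ∑' n, ‖(P N).coeff n - d n‖ * |R| ^ n) atTop (𝓝 0) := by
    have := tendsto_tsum_of_dominated_convergence (𝓕 := atTop)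
      (f := fun N n => ‖(P N).coeff n - d n‖ * |R| ^ n) (g := fun n => 0)
      ((summable_pow_div_factorial |R|).mul_left 2) (fun n => by
        simpa using (((hd n).sub_const (d n)).norm.mul_const (|R| ^ n)))
      (hb.mono fun N h n => by
        rw [Real.norm_of_nonneg (by positivity), ← mul_assoc]
        gcongr
        linarith [norm_sub_le ((P N).coeff n) (d n), h n, hdb n])
    simpa using this
  rw [Metric.tendstoUniformlyOn_iff]
  intro ε hε
  filter_upwards [hb, hlim.eventually_lt_const hε] with N hN hlt w hw
  have hwR : ‖w‖ ≤ |R| := (hR w hw).trans (le_abs_self R)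
  have hsum : ∀ c : ℕ → ℂ, (∀ n, ‖c n‖ ≤ 1 / n.factorial) → Summable fun n => c n * w ^ n :=
    fun c hc => Summable.of_norm_bounded (summable_pow_div_factorial ‖w‖) fun n => by
      rw [norm_mul, norm_pow]
      exact mul_le_mul_of_nonneg_right (hc n) (by positivity)
  refine lt_of_le_of_lt ?_ hlt
  have hS : Summable fun n => ‖(P N).coeff n - d n‖ * |R| ^ n :=
    Summable.of_nonneg_of_le (fun n => by positivity) (fun n => by
      rw [← mul_assoc]
      gcongr
      linarith [norm_sub_le ((P N).coeff n) (d n), hN n, hdb n])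
      ((summable_pow_div_factorial |R|).mul_left 2)
  rw [dist_comm, dist_eq_norm, eval_eq_tsum, ← (hsum _ hN).tsum_sub (hsum _ hdb)]
  refine tsum_of_norm_bounded hS.hasSum fun n => ?_
  rw [← sub_mul, norm_mul, norm_pow]
  gcongr

theorem posRootedLimit_besselEntire {ν : ℝ} (hν : 0 ≤ ν) : PosRootedLimit (besselEntire ν) :=
  ⟨fun N => besselApprox ν N N, fun N => posRooted_besselApprox hν N N,
    tendstoLocallyUniformlyOn_of_coeff
      ((eventually_gt_atTop 0).mono fun _ hN n => norm_coeff_besselApprox_le hν hN n)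
      fun n => tendsto_coeff_besselApprox hν n⟩

lemma abs_besselCoeff_le {ν : ℝ} (hν : 0 ≤ ν) (n : ℕ) :
    ‖(besselCoeff ν n : ℂ)‖ ≤ 1 / n.factorial :=
  le_of_tendsto (tendsto_coeff_besselApprox hν n).norm
    ((eventually_gt_atTop 0).mono fun _ hN => norm_coeff_besselApprox_le hν hN n)

lemma summable_besselEntire {ν : ℝ} (hν : 0 ≤ ν) (w : ℂ) :
    Summable fun n => (besselCoeff ν n : ℂ) * w ^ n :=
  Summable.of_norm_bounded (summable_pow_div_factorial ‖w‖) fun n => by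
    rw [norm_mul, norm_pow]
    exact mul_le_mul_of_nonneg_right (abs_besselCoeff_le hν n) (by positivity)

/-! ### Derivative, contiguous relation and differential equation of `Λ`. -/

lemma besselCoeff_succ_mul {ν : ℝ} (hν : 0 ≤ ν) (n : ℕ) :
    (n + 1) * besselCoeff ν (n + 1) = -1 / (4 * (ν + 1)) * besselCoeff (ν + 1) n := by
  simp only [besselCoeff, Finset.prod_range_succ' _ n, Nat.factorial_succ]
  have h : ∀ k : ℕ, ν + 1 + ((k + 1 : ℕ) : ℝ) = ν + 1 + 1 + k := fun k => by push_cast; ring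
  have hp : 0 < ∏ k ∈ Finset.range n, (ν + 1 + 1 + k) :=
    Finset.prod_pos fun k _ => by positivity
  simp only [h, Nat.cast_zero, add_zero]
  push_cast
  field_simp
  ring

lemma besselCoeff_add_one {ν : ℝ} (hν : 0 ≤ ν) (n : ℕ) :
    (ν + 1 + n) * besselCoeff (ν + 1) n = (ν + 1) * besselCoeff ν n := by
  have h : ∀ k : ℕ, ν + 1 + ((k + 1 : ℕ) : ℝ) = ν + 1 + 1 + k := fun k => by push_cast; ring
  have key := (Finset.prod_range_succ' (fun k : ℕ => ν + 1 + (k : ℝ)) n).symm.trans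
    (Finset.prod_range_succ _ n)
  simp only [h, Nat.cast_zero, add_zero] at key
  have hp : 0 < ∏ k ∈ Finset.range n, (ν + 1 + 1 + k) :=
    Finset.prod_pos fun k _ => by positivity
  have hp' : 0 < ∏ k ∈ Finset.range n, (ν + 1 + k) :=
    Finset.prod_pos fun k _ => by positivity
  simp only [besselCoeff]
  field_simp
  linear_combination -key

lemma hasDerivAt_besselEntire {ν : ℝ} (hν : 0 ≤ ν) (w : ℂ) :
    HasDerivAt (besselEntire ν) (-1 / (4 * (ν + 1)) * besselEntire (ν + 1) w) w := by
  set R : ℝ := ‖w‖ + 1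
  have hu : Summable fun n : ℕ => (n : ℝ) * (1 / n.factorial * R ^ (n - 1)) := by
    rw [← summable_nat_add_iff 1]
    refine (summable_pow_div_factorial R).congr fun n => ?_
    rw [Nat.factorial_succ, Nat.add_sub_cancel]
    push_cast
    field_simp
  have key := hasDerivAt_tsum_of_isPreconnected (𝕜 := ℂ) (y₀ := w) (y := w)
    (g := fun n z => (besselCoeff ν n : ℂ) * z ^ n)
    (g' := fun n z => (besselCoeff ν n : ℂ) * (n * z ^ (n - 1))) hu
    (Metric.isOpen_ball (x := (0 : ℂ)) (ε := R)) (convex_ball _ _).isPreconnected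
    (fun n y _ => (hasDerivAt_pow n y).const_mul _) (fun n y hy => by
      have hy' : ‖y‖ ≤ R := by simpa using (mem_ball_zero_iff.1 hy).le
      rw [norm_mul, norm_mul, norm_pow, Complex.norm_natCast, mul_left_comm]
      gcongr
      exact abs_besselCoeff_le hν n) (by simp [R]) (summable_besselEntire hν w) (by simp [R])
  refine key.congr_deriv ?_
  have hs : Summable fun n : ℕ => (besselCoeff ν n : ℂ) * (n * w ^ (n - 1)) :=
    Summable.of_norm_bounded hu fun n => by
      rw [norm_mul, norm_mul, norm_pow, Complex.norm_natCast, mul_left_comm]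
      gcongr
      · exact abs_besselCoeff_le hν n
      · simp [R]
  rw [hs.tsum_eq_zero_add, besselEntire, ← tsum_mul_left]
  simp only [CharP.cast_eq_zero, zero_mul, mul_zero, zero_add, Nat.add_sub_cancel]
  refine tsum_congr fun n => ?_
  have := congrArg (fun x : ℝ => (x : ℂ)) (besselCoeff_succ_mul hν n)
  push_cast at this ⊢
  linear_combination w ^ n * this

lemma differentiable_besselEntire {ν : ℝ} (hν : 0 ≤ ν) : Differentiable ℂ (besselEntire ν) :=
  fun w => (hasDerivAt_besselEntire hν w).differentiableAt

lemma besselEntire_contiguous {ν : ℝ} (hν : 0 ≤ ν) (w : ℂ) :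
    w * deriv (besselEntire (ν + 1)) w + (ν + 1) * besselEntire (ν + 1) w =
      (ν + 1) * besselEntire ν w := by
  have hν1 : 0 ≤ ν + 1 := by positivity
  have h2 := summable_besselEntire (by positivity : 0 ≤ ν + 1 + 1) w
  have hd : w * deriv (besselEntire (ν + 1)) w =
      ∑' n : ℕ, (n : ℂ) * besselCoeff (ν + 1) n * w ^ n := by
    rw [(hasDerivAt_besselEntire hν1 w).deriv, besselEntire, ← tsum_mul_left, ← tsum_mul_left]
    have hs : ∀ n : ℕ, ((n + 1 : ℕ) : ℂ) * besselCoeff (ν + 1) (n + 1) * w ^ (n + 1) =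
        w * (-1 / (4 * ((ν + 1 : ℝ) + 1)) * (besselCoeff (ν + 1 + 1) n * w ^ n)) := fun n => by
      have := congrArg (fun x : ℝ => (x : ℂ)) (besselCoeff_succ_mul hν1 n)
      push_cast at this ⊢
      linear_combination w ^ (n + 1) * this
    have hsum : Summable fun n : ℕ => (n : ℂ) * besselCoeff (ν + 1) n * w ^ n := by
      rw [← summable_nat_add_iff 1]
      exact ((h2.mul_left _).mul_left w).congr fun n => (hs n).symm
    rw [hsum.tsum_eq_zero_add]
    simp only [hs, Nat.cast_zero, zero_mul, zero_add]
  have hsum : Summable fun n : ℕ => (n : ℂ) * besselCoeff (ν + 1) n * w ^ n := by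
    refine (((summable_besselEntire hν w).mul_left ((ν : ℂ) + 1)).sub
      ((summable_besselEntire hν1 w).mul_left ((ν : ℂ) + 1))).congr fun n => ?_
    have := congrArg (fun x : ℝ => (x : ℂ)) (besselCoeff_add_one hν n)
    push_cast at this
    linear_combination -w ^ n * this
  rw [hd, besselEntire, besselEntire, ← tsum_mul_left, ← tsum_mul_left,
    ← hsum.tsum_add ((summable_besselEntire hν1 w).mul_left _)]
  refine tsum_congr fun n => ?_
  have := congrArg (fun x : ℝ => (x : ℂ)) (besselCoeff_add_one hν n)
  push_cast at this
  linear_combination w ^ n * this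

/-- The differential equation `4 w Λ'' + 4 (ν + 1) Λ' + Λ = 0`. -/
lemma besselEntire_ode {ν : ℝ} (hν : 0 ≤ ν) (w : ℂ) :
    4 * w * deriv (deriv (besselEntire ν)) w + 4 * (ν + 1) * deriv (besselEntire ν) w +
      besselEntire ν w = 0 := by
  have hd : deriv (besselEntire ν) = fun w => -1 / (4 * (ν + 1)) * besselEntire (ν + 1) w :=
    funext fun w => (hasDerivAt_besselEntire hν w).deriv
  have hdiff := differentiable_besselEntire (by positivity : 0 ≤ ν + 1)
  have hne : (ν : ℂ) + 1 ≠ 0 := by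
    have : ν + 1 ≠ 0 := by positivity
    exact_mod_cast this
  -- With `Λ_ν'` a multiple of `Λ_{ν+1}`, the second-order equation becomes the first-order
  -- contiguous relation.
  rw [hd, deriv_const_mul _ (hdiff w)]
  have := besselEntire_contiguous hν w
  field_simp
  linear_combination -this

/-! ### The entire function `W` as a limit of polynomials with positive roots. -/

/-- The entire function `W` with `2 ^ ν Γ(ν + 1) N_ν(z) / Q(ν) = z ^ ν W(z²)`. -/
noncomputable def besselNEntire (a b c ν : ℝ) (w : ℂ) : ℂ :=
  besselEntire ν w + ((4 * a * ν + 2 * a + 2 * b) * (w * deriv (besselEntire ν) w) +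
    4 * a * (w ^ 2 * deriv (deriv (besselEntire ν)) w)) / quadQ a b c ν

lemma besselNEntire_eq_of_ode {a b c ν : ℝ} (hν : 0 ≤ ν) (hQ : quadQ a b c ν ≠ 0) (w : ℂ) :
    besselNEntire a b c ν w = besselEntire ν w +
      (2 * (b - a) / quadQ a b c ν : ℝ) * w * deriv (besselEntire ν) w -
      (a / quadQ a b c ν : ℝ) * w * besselEntire ν w := by
  have hQ' : (quadQ a b c ν : ℂ) ≠ 0 := by exact_mod_cast hQ
  have := besselEntire_ode hν w
  rw [besselNEntire]
  push_cast
  field_simp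
  linear_combination a * w * this

/-- If `Q(x) = a (x - r₁) (x - r₂)`, then `Q(ν + 2 D) / Q(ν)` is the product of the operators `1 + 2
D / (ν - rᵢ)`. The terms with coefficient `0` are written to match the shape of
`PosRootedLimit.euler`. -/
lemma besselNEntire_eq_of_factor {a b c ν r₁ r₂ : ℝ} (hν : 0 ≤ ν) (ha : a ≠ 0)
    (hsum : a * (r₁ + r₂) = a - b) (hprod : a * (r₁ * r₂) = c) (h₁ : ν ≠ r₁) (h₂ : ν ≠ r₂)
    (w : ℂ) :
    let U := fun w => besselEntire ν w + (2 / (ν - r₁) : ℝ) * w * deriv (besselEntire ν) w -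
      (0 : ℝ) * w * besselEntire ν w
    besselNEntire a b c ν w = U w + (2 / (ν - r₂) : ℝ) * w * deriv U w - (0 : ℝ) * w * U w := by
  intro U
  have hd := differentiable_besselEntire hν
  have hd' : Differentiable ℂ (deriv (besselEntire ν)) := hd.deriv
  have hU : U = fun w => besselEntire ν w +
      (2 / (ν - r₁) : ℝ) * (w * deriv (besselEntire ν) w) := by
    funext w; simp [U, mul_assoc]
  have hder : deriv U w = deriv (besselEntire ν) w + (2 / (ν - r₁) : ℝ) *
      (deriv (besselEntire ν) w + w * deriv (deriv (besselEntire ν)) w) := by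
    rw [hU]
    refine HasDerivAt.deriv ((hd w).hasDerivAt.add (HasDerivAt.const_mul _ ?_))
    exact ((hasDerivAt_id w).mul (hd' w).hasDerivAt).congr_deriv (by simp)
  have hq : quadQ a b c ν = a * (ν - r₁) * (ν - r₂) := by
    rw [quadQ]
    linear_combination ν * hsum - hprod
  rw [hder, besselNEntire, hU, hq]
  have ha' : (a : ℂ) ≠ 0 := by exact_mod_cast ha
  have h₁' : (ν : ℂ) - r₁ ≠ 0 := by
    have := sub_ne_zero.2 h₁
    exact_mod_cast this
  have h₂' : (ν : ℂ) - r₂ ≠ 0 := by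
    have := sub_ne_zero.2 h₂
    exact_mod_cast this
  have hs := congrArg (fun x : ℝ => (x : ℂ)) hsum
  push_cast at hs ⊢
  field_simp
  linear_combination 2 * w * deriv (besselEntire ν) w * hs

/-- Real roots of `Q` lie strictly below `ν`, so the factored form has positive coefficients `2 / (ν
- rᵢ)`. When `c > 0` and `a ≥ 0` the roots may be nonreal or absent, and the form reduced by
Bessel's equation has the right signs instead. -/
theorem posRootedLimit_besselNEntire {a b c ν : ℝ}
    (habc : (c = 0 ∧ a ≠ b) ∨ (0 < c ∧ a < b)) (hν : 0 ≤ ν)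
    (hν₀ : ∀ x : ℝ, quadQ a b c x = 0 → x ≤ ν) (hQ : quadQ a b c ν ≠ 0) :
    PosRootedLimit (besselNEntire a b c ν) := by
  have hA : 0 ≤ a / quadQ a b c ν → 0 ≤ 2 * (b - a) / quadQ a b c ν →
      PosRootedLimit (besselNEntire a b c ν) := fun h1 h2 => by
    have := (posRootedLimit_besselEntire hν).euler h1 h2
    rwa [← funext (besselNEntire_eq_of_ode hν hQ)] at this
  have hB : ∀ r₁ r₂ : ℝ, a ≠ 0 → a * (r₁ + r₂) = a - b → a * (r₁ * r₂) = c →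
      PosRootedLimit (besselNEntire a b c ν) := fun r₁ r₂ ha hs hp => by
    have hroot : ∀ r, (r = r₁ ∨ r = r₂) → r < ν := by
      intro r hr
      have h0 : quadQ a b c r = 0 := by
        rw [quadQ]
        rcases hr with rfl | rfl
        · linear_combination r * hs - hp
        · linear_combination r * hs - hp
      exact lt_of_le_of_ne (hν₀ r h0) fun h => hQ (h ▸ h0)
    have h₁ := hroot r₁ (Or.inl rfl)
    have h₂ := hroot r₂ (Or.inr rfl)
    have := ((posRootedLimit_besselEntire hν).euler (A := 0) (B := 2 / (ν - r₁)) le_rfl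
      (div_nonneg zero_le_two (by linarith))).euler (A := 0) (B := 2 / (ν - r₂)) le_rfl
      (div_nonneg zero_le_two (by linarith))
    rwa [← funext (besselNEntire_eq_of_factor hν ha hs hp h₁.ne' h₂.ne')] at this
  rcases habc with ⟨rfl, hab⟩ | ⟨hc, hab⟩
  -- For `c = 0`, either `Q(x) = b x` and the coefficient is `2 / ν`, or the roots are `0` and `1 -
  -- b / a`.
  · rcases eq_or_ne a 0 with rfl | ha
    · have hq : quadQ 0 b 0 ν = b * ν := by simp [quadQ]
      have hb : b ≠ 0 := hab.symm
      refine hA (by simp) ?_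
      rw [hq, sub_zero, mul_comm b, mul_div_mul_right _ _ hb]
      positivity
    · exact hB 0 (1 - b / a) ha (by field_simp; ring) (by simp)
  · rcases le_or_gt 0 a with ha | ha
    · have hq : 0 ≤ quadQ a b c ν := by
        have : quadQ a b c ν = a * ν ^ 2 + (b - a) * ν + c := by rw [quadQ]; ring
        have h1 := mul_nonneg (sub_nonneg.2 hab.le) hν
        rw [this]
        positivity
      exact hA (div_nonneg ha hq) (div_nonneg (by linarith) hq)
    -- Since `a < 0 < c`, the discriminant of `a x² + (b - a) x + c` is positive and both roots are
    -- real.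
    · have hdisc : 0 ≤ (b - a) ^ 2 - 4 * a * c := by
        nlinarith [mul_pos (neg_pos.2 ha) hc, sq_nonneg (b - a)]
      have hsq := Real.sq_sqrt hdisc
      set s := Real.sqrt ((b - a) ^ 2 - 4 * a * c)
      refine hB ((a - b + s) / (2 * a)) ((a - b - s) / (2 * a)) ha.ne ?_ ?_
      · field_simp [ha.ne]
        ring
      · have := ha.ne
        field_simp
        linear_combination -hsq

/-! ### From the Bessel series to `W`. -/

lemma Gamma_add_nat {ν : ℝ} (hν : 0 ≤ ν) (n : ℕ) :
    Complex.Gamma ((n : ℂ) + (ν : ℂ) + 1) =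
      ((Real.Gamma (ν + 1) * ∏ k ∈ Finset.range n, (ν + 1 + k) : ℝ) : ℂ) := by
  have : ((n : ℂ) + (ν : ℂ) + 1) = ((n + ν + 1 : ℝ) : ℂ) := by push_cast; rfl
  rw [this, Complex.Gamma_ofReal]
  congr 1
  induction n with
  | zero => simp
  | succ n ih =>
    rw [Finset.prod_range_succ, ← mul_assoc, ← ih (by push_cast; rfl)]
    have h : ((n + 1 : ℕ) : ℝ) + ν + 1 = (n + ν + 1) + 1 := by push_cast; ring
    rw [h, Real.Gamma_add_one (by positivity)]
    ring

lemma half_cpow {z : ℂ} (hz : z ≠ 0) (ν : ℝ) :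
    (z / 2) ^ (ν : ℂ) = z ^ (ν : ℂ) / ((2 ^ ν : ℝ) : ℂ) := by
  have h2 : (2 : ℂ) = ((2 : ℝ) : ℂ) := by simp
  have hz2 : z / 2 ≠ 0 := div_ne_zero hz two_ne_zero
  have hz' : z = ((2 : ℝ) : ℂ) * (z / 2) := by rw [← h2]; field_simp
  have : z ^ (ν : ℂ) = ((2 ^ ν : ℝ) : ℂ) * (z / 2) ^ (ν : ℂ) := by
    conv_lhs => rw [hz']
    rw [Complex.cpow_def_of_ne_zero (hz' ▸ hz), Complex.log_ofReal_mul two_pos hz2, add_mul,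
      Complex.exp_add, ← Complex.cpow_def_of_ne_zero hz2, Real.rpow_def_of_pos two_pos,
      Complex.ofReal_exp, Complex.ofReal_mul]
  rw [this, mul_div_cancel_left₀]
  exact_mod_cast (Real.rpow_pos_of_pos two_pos ν).ne'

lemma besselJ_eq {ν : ℝ} (hν : 0 ≤ ν) {z : ℂ} (hz : z ≠ 0) :
    besselJ ν z = ((2 ^ ν * Real.Gamma (ν + 1) : ℝ) : ℂ)⁻¹ *
      (z ^ (ν : ℂ) * besselEntire ν (z ^ 2)) := by
  rw [besselJ, besselEntire, ← mul_assoc, ← tsum_mul_left]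
  refine tsum_congr fun n => ?_
  have hz2 : z / 2 ≠ 0 := div_ne_zero hz two_ne_zero
  have h2 : (z / 2) ^ (2 * (n : ℂ)) = z ^ (2 * n) / 2 ^ (2 * n) := by
    rw [← div_pow, ← Complex.cpow_natCast]
    push_cast
    rfl
  rw [Complex.cpow_add _ _ hz2, half_cpow hz, h2, Gamma_add_nat hν, besselCoeff]
  have hG : (Real.Gamma (ν + 1) : ℂ) ≠ 0 := by
    exact_mod_cast (Real.Gamma_pos_of_pos (by positivity)).ne'
  have hp : ((∏ k ∈ Finset.range n, (ν + 1 + k) : ℝ) : ℂ) ≠ 0 := by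
    exact_mod_cast (Finset.prod_pos fun k _ => by positivity).ne'
  have h2ν : ((2 ^ ν : ℝ) : ℂ) ≠ 0 := by
    exact_mod_cast (Real.rpow_pos_of_pos two_pos ν).ne'
  rw [Complex.ofReal_mul, Complex.ofReal_mul, Complex.ofReal_div, Complex.ofReal_mul]
  push_cast at hp h2ν ⊢
  rw [pow_mul, pow_mul, div_pow]
  norm_num
  field_simp

/-- If `f(z) = K z ^ ν F(z²)` on the slit plane, then `z f'(z)` has the same form. -/
lemma mul_deriv_cpow_mul_sq {ν : ℝ} {K : ℂ} {F f : ℂ → ℂ} (hF : Differentiable ℂ F)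
    (hf : ∀ z ∈ Complex.slitPlane, f z = K * (z ^ (ν : ℂ) * F (z ^ 2))) {z : ℂ}
    (hz : z ∈ Complex.slitPlane) :
    DifferentiableAt ℂ f z ∧
      z * deriv f z = K * (z ^ (ν : ℂ) * (ν * F (z ^ 2) + 2 * (z ^ 2 * deriv F (z ^ 2)))) := by
  have hz0 := Complex.slitPlane_ne_zero hz
  have h1 : HasDerivAt (fun z : ℂ => z ^ (ν : ℂ)) (ν * z ^ ((ν : ℂ) - 1)) z := by
    simpa using (hasDerivAt_id z).cpow_const (c := (ν : ℂ)) hz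
  have h2 : HasDerivAt (fun z : ℂ => F (z ^ 2)) (deriv F (z ^ 2) * (2 * z)) z :=
    (HasDerivAt.comp z (hF (z ^ 2)).hasDerivAt (hasDerivAt_pow 2 z)).congr_deriv (by simp)
  have h3 := ((h1.mul h2).const_mul K).congr_of_eventuallyEq
    (eventually_of_mem (Complex.isOpen_slitPlane.mem_nhds hz) hf)
  refine ⟨h3.differentiableAt, ?_⟩
  rw [h3.deriv, Complex.cpow_sub _ _ hz0, Complex.cpow_one]
  field_simp

theorem normConst_mul_besselN {a b c ν : ℝ} (hν : 0 ≤ ν) (hQ : quadQ a b c ν ≠ 0) {z : ℂ}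
    (hz : z ∈ Complex.slitPlane) :
    (normConst a b c ν : ℂ) * besselN a b c ν z =
      z ^ (ν : ℂ) * besselNEntire a b c ν (z ^ 2) := by
  have hd := differentiable_besselEntire hν
  have hd' : Differentiable ℂ (deriv (besselEntire ν)) := hd.deriv
  set K := ((2 ^ ν * Real.Gamma (ν + 1) : ℝ) : ℂ)⁻¹ with hK
  have hJ : ∀ z ∈ Complex.slitPlane, besselJ ν z = K * (z ^ (ν : ℂ) * besselEntire ν (z ^ 2)) :=
    fun z hz => besselJ_eq hν (Complex.slitPlane_ne_zero hz)
  have h1 : ∀ z ∈ Complex.slitPlane, z * deriv (besselJ ν) z = K * (z ^ (ν : ℂ) *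
      (fun w => ν * besselEntire ν w + 2 * (w * deriv (besselEntire ν) w)) (z ^ 2)) :=
    fun z hz => (mul_deriv_cpow_mul_sq hd hJ hz).2
  have hJd : DifferentiableAt ℂ (deriv (besselJ ν)) z :=
    (DifferentiableOn.deriv (fun z hz =>
      (mul_deriv_cpow_mul_sq hd hJ hz).1.differentiableWithinAt)
      Complex.isOpen_slitPlane).differentiableAt (Complex.isOpen_slitPlane.mem_nhds hz)
  have hF1 : Differentiable ℂ
      fun w => ν * besselEntire ν w + 2 * (w * deriv (besselEntire ν) w) := by fun_prop
  have h2 := (mul_deriv_cpow_mul_sq hF1 h1 hz).2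
  have h3 : deriv (fun z => z * deriv (besselJ ν) z) z =
      deriv (besselJ ν) z + z * deriv (deriv (besselJ ν)) z :=
    (((hasDerivAt_id z).mul hJd.hasDerivAt).congr_deriv (by simp)).deriv
  have h4 : deriv (fun w => ν * besselEntire ν w + 2 * (w * deriv (besselEntire ν) w)) (z ^ 2) =
      ν * deriv (besselEntire ν) (z ^ 2) + 2 * (deriv (besselEntire ν) (z ^ 2) +
        z ^ 2 * deriv (deriv (besselEntire ν)) (z ^ 2)) := by
    refine HasDerivAt.deriv (((hd _).hasDerivAt.const_mul _).add (HasDerivAt.const_mul _ ?_))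
    exact ((hasDerivAt_id _).mul (hd' _).hasDerivAt).congr_deriv (by simp)
  have h1z := h1 z hz
  rw [h3, h4] at h2
  simp only at h1z h2
  have hQ' : (quadQ a b c ν : ℂ) ≠ 0 := by exact_mod_cast hQ
  have hconst : (normConst a b c ν : ℂ) = K⁻¹ / quadQ a b c ν := by
    rw [hK, inv_inv, normConst, Complex.ofReal_div]
  have hK0 : K ≠ 0 := by
    refine inv_ne_zero (Complex.ofReal_ne_zero.2 ?_)
    exact (mul_pos (Real.rpow_pos_of_pos two_pos _)
      (Real.Gamma_pos_of_pos (by positivity))).ne'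
  have hN : besselN a b c ν z = K * (z ^ (ν : ℂ) * (quadQ a b c ν *
      besselNEntire a b c ν (z ^ 2))) := by
    rw [besselN, besselNEntire, hJ z hz, mul_add, mul_div_cancel₀ _ hQ', quadQ]
    push_cast
    -- This is `N_ν = a θ² J_ν + (b - a) θ J_ν + c J_ν`, with `h1z` and `h2` supplying `θ J_ν` and
    -- `θ² J_ν`.
    linear_combination a * h2 + (b - a) * h1z
  rw [hN, hconst]
  field_simp

/-! ### Holomorphic inverses and subordination. -/

/-- The inverse of an injective holomorphic function on an open connected set is holomorphic. -/
theorem exists_differentiableOn_inverse {U : Set ℂ} (hU : IsOpen U) (hc : IsPreconnected U)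
    (hnt : U.Nontrivial) {φ : ℂ → ℂ} (hφ : DifferentiableOn ℂ φ U) (hinj : InjOn φ U) :
    ∃ ψ : ℂ → ℂ, DifferentiableOn ℂ ψ (φ '' U) ∧ ∀ z ∈ U, ψ (φ z) = z := by
  have han : AnalyticOnNhd ℂ φ U := hφ.analyticOnNhd hU
  have hopen : ∀ s ⊆ U, IsOpen s → IsOpen (φ '' s) := by
    refine (han.is_constant_or_isOpen hc).resolve_left ?_
    rintro ⟨w, hw⟩
    obtain ⟨x, hx, y, hy, hxy⟩ := hnt
    exact hxy (hinj hx hy ((hw x hx).trans (hw y hy).symm))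
  set ψ := Function.invFunOn φ U with hψ
  have hleft : ∀ z ∈ U, ψ (φ z) = z := fun z hz => hinj.leftInvOn_invFunOn hz
  have hcont : ∀ z ∈ U, ContinuousAt ψ (φ z) := by
    intro z hz
    rw [ContinuousAt, hleft z hz, tendsto_def]
    intro s hs
    obtain ⟨t, hts, hto, hzt⟩ := mem_nhds_iff.1 (inter_mem hs (hU.mem_nhds hz))
    refine mem_of_superset ((hopen t (hts.trans inter_subset_right) hto).mem_nhds
      (mem_image_of_mem φ hzt)) ?_
    rintro _ ⟨y, hy, rfl⟩
    rw [mem_preimage, hleft y (hts hy).2]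
    exact (hts hy).1
  have hdiff : ∀ z ∈ U, deriv φ z ≠ 0 → DifferentiableAt ℂ ψ (φ z) := by
    intro z hz hd
    have h1 : HasDerivAt φ (deriv φ z) (ψ (φ z)) := by
      rw [hleft z hz]
      exact (hφ.differentiableAt (hU.mem_nhds hz)).hasDerivAt
    refine (h1.of_local_left_inverse (hcont z hz) hd ?_).differentiableAt
    filter_upwards [(hopen U Subset.rfl hU).mem_nhds (mem_image_of_mem φ hz)]
    rintro _ ⟨y, hy, rfl⟩
    rw [hleft y hy]
  refine ⟨ψ, ?_, hleft⟩
  rintro _ ⟨z, hz, rfl⟩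
  -- Zeros of `φ'` are isolated, as `φ` is injective. So the continuous inverse is differentiable
  -- near `φ z` except perhaps at that point, which is a removable singularity.
  refine (Complex.analyticAt_of_differentiable_on_punctured_nhds_of_continuousAt ?_
    (hcont z hz)).differentiableAt.differentiableWithinAt
  have hpunct : ∀ᶠ y in 𝓝[≠] z, deriv φ y ≠ 0 := by
    refine (han z hz).deriv.eventually_eq_zero_or_eventually_ne_zero.resolve_left fun h => ?_
    have hev : ∀ᶠ y in 𝓝 z, φ y = φ z := by
      obtain ⟨ε, hε, hball⟩ := Metric.eventually_nhds_iff_ball.1 (h.and (hU.mem_nhds hz))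
      filter_upwards [Metric.ball_mem_nhds z hε] with y hy
      refine (convex_ball z ε).is_const_of_fderivWithin_eq_zero (𝕜 := ℂ)
        (hφ.mono fun x hx => (hball x hx).2) (fun x hx => ?_) hy (Metric.mem_ball_self hε)
      rw [fderivWithin_of_isOpen Metric.isOpen_ball hx]
      ext
      simp [(hball x hx).1]
    obtain ⟨t, ht, hto, hzt⟩ := mem_nhds_iff.1 (hev.and (hU.mem_nhds hz))
    have hpre : (𝓝[≠] z).NeBot := inferInstance
    obtain ⟨y, hyt, hyz⟩ := (hpre.nonempty_of_mem (inter_mem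
      (mem_nhdsWithin_of_mem_nhds (hto.mem_nhds hzt)) self_mem_nhdsWithin))
    exact hyz (hinj (ht hyt).2 hz (ht hyt).1)
  have hpre : Tendsto ψ (𝓝[≠] φ z) (𝓝[≠] z) := by
    refine tendsto_nhdsWithin_iff.2 ⟨?_, ?_⟩
    · have := (hcont z hz).tendsto
      rw [hleft z hz] at this
      exact this.mono_left nhdsWithin_le_nhds
    · filter_upwards [mem_nhdsWithin_of_mem_nhds ((hopen U Subset.rfl hU).mem_nhds
        (mem_image_of_mem φ hz)), self_mem_nhdsWithin]
      rintro _ ⟨y, hy, rfl⟩ hne h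
      rw [mem_singleton_iff, hleft y hy] at h
      exact hne (by rw [h]; rfl)
  filter_upwards [hpre.eventually hpunct, mem_nhdsWithin_of_mem_nhds
    ((hopen U Subset.rfl hU).mem_nhds (mem_image_of_mem φ hz))]
  rintro _ hy ⟨y, hyU, rfl⟩
  rw [hleft y hyU] at hy
  exact hdiff y hyU hy

/-- Univalence makes `φ⁻¹ ∘ q` holomorphic on the disk; this is the required `ω`. -/
theorem IsMaMinda.subordinate {φ q : ℂ → ℂ} (hφ : IsMaMinda φ)
    (hq : DifferentiableOn ℂ q (Metric.ball 0 1)) (hq0 : q 0 = 1)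
    (hmaps : ∀ z ∈ Metric.ball (0 : ℂ) 1, q z ∈ φ '' Metric.ball 0 1) : Subordinate q φ := by
  obtain ⟨ψ, hψ, hleft⟩ := exists_differentiableOn_inverse Metric.isOpen_ball
    (convex_ball (0 : ℂ) 1).isPreconnected
    ⟨0, by simp, 1 / 2, by rw [mem_ball_zero_iff]; norm_num, by norm_num⟩
    hφ.holomorphic hφ.univalent
  refine ⟨hq, ψ ∘ q, hψ.comp hq hmaps, fun z hz => ?_, ?_, fun z hz => ?_⟩
  · obtain ⟨y, hy, h⟩ := hmaps z hz
    rw [Function.comp_apply, ← h, hleft y hy]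
    exact hy
  · rw [Function.comp_apply, hq0, ← hφ.map_zero, hleft 0 (by simp)]
  · obtain ⟨y, hy, h⟩ := hmaps z hz
    rw [Function.comp_apply, ← h, hleft y hy]

/-- A function `z E(z)` with `E(0) = 1` and logarithmic derivative `z E'(z) / E(z)` bounded by a
constant less than `β` belongs to `𝒮*(φ)` if `φ(𝔻)` contains the disk of radius `β` about `1`. -/
theorem IsMaMinda.isMaMindaStarlike {φ f E K : ℂ → ℂ} {β M : ℝ} (hφ : IsMaMinda φ)
    (hβ : Metric.ball (1 : ℂ) β ⊆ φ '' Metric.ball 0 1)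
    (hf : ∀ z ∈ Metric.ball (0 : ℂ) 1, f z = z * E z)
    (hE0 : E 0 = 1) (hE : ∀ z ∈ Metric.ball (0 : ℂ) 1, HasDerivAt E (E z * K z) z)
    (hne : ∀ z ∈ Metric.ball (0 : ℂ) 1, E z ≠ 0)
    (hK : DifferentiableOn ℂ K (Metric.ball 0 1))
    (hM : M < β) (hKM : ∀ z ∈ Metric.ball (0 : ℂ) 1, ‖z * K z‖ ≤ M) :
    IsMaMindaStarlike φ f := by
  have hder : ∀ z ∈ Metric.ball (0 : ℂ) 1, HasDerivAt f (E z + z * (E z * K z)) z := by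
    intro z hz
    refine (((hasDerivAt_id z).mul (hE z hz)).congr_of_eventuallyEq
      (eventually_of_mem (Metric.isOpen_ball.mem_nhds hz) hf)).congr_deriv ?_
    simp
  have h0 : (0 : ℂ) ∈ Metric.ball (0 : ℂ) 1 := by simp
  have hq : ∀ z ∈ Metric.ball (0 : ℂ) 1, starQuotient f z = 1 + z * K z := by
    intro z hz
    rw [starQuotient]
    split_ifs with h
    · simp [h]
    · rw [(hder z hz).deriv, hf z hz]
      have := hne z hz
      field_simp
  refine ⟨⟨fun z hz => (hder z hz).differentiableAt.differentiableWithinAt, ?_, ?_⟩, ?_, ?_⟩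
  · simp [hf 0 h0]
  · simp [(hder 0 h0).deriv, hE0]
  · intro z hz hz0
    rw [hf z hz]
    exact mul_ne_zero hz0 (hne z hz)
  · refine hφ.subordinate (DifferentiableOn.congr (f := fun z => 1 + z * K z) ?_ hq) ?_ ?_
    · exact (differentiableOn_id.mul hK).const_add 1
    · simp [hq 0 h0]
    · intro z hz
      refine hβ ?_
      rw [hq z hz, mem_ball_iff_norm, add_sub_cancel_left]
      exact (hKM z hz).trans_lt hM

/-! ### Branches: expressing the normalized functions through `W`. -/

lemma dense_slitPlane : Dense Complex.slitPlane := by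
  intro z
  rw [Metric.mem_closure_iff]
  intro ε hε
  by_cases hz : z.im = 0
  · refine ⟨z + ((ε / 2 : ℝ) : ℂ) * Complex.I, ?_, ?_⟩
    · rw [Complex.mem_slitPlane_iff]
      right
      simp [hz, hε.ne']
    · rw [dist_self_add_right, norm_mul, Complex.norm_I, mul_one,
        Complex.norm_of_nonneg (by positivity)]
      linarith
  · exact ⟨z, Or.inr hz, by simpa using hε⟩

lemma extendFrom_slitPlane {f G : ℂ → ℂ} (hG : Continuous G)
    (h : EqOn f G Complex.slitPlane) : extendFrom Complex.slitPlane f = G := by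
  funext z
  refine extendFrom_eq (dense_slitPlane z) ?_
  exact (hG.continuousWithinAt.tendsto).congr' ((h.symm.eventuallyEq_nhdsWithin))

/-- Take for `L` the primitive of `K` that vanishes at `0`; then `E e^{-L}` has derivative `0` and
equals `1` at the origin. -/
lemma exists_log_of_hasDerivAt {E K : ℂ → ℂ} (hK : DifferentiableOn ℂ K (Metric.ball 0 1))
    (hE : ∀ z ∈ Metric.ball (0 : ℂ) 1, HasDerivAt E (E z * K z) z) (hE0 : E 0 = 1) :
    ∃ L : ℂ → ℂ, DifferentiableOn ℂ L (Metric.ball 0 1) ∧ L 0 = 0 ∧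
      ∀ z ∈ Metric.ball (0 : ℂ) 1, Complex.exp (L z) = E z := by
  obtain ⟨L, hL0, hL⟩ := hK.isExactOn_ball.with_val_at 0 0
  refine ⟨L, fun z hz => (hL z hz).differentiableAt.differentiableWithinAt, hL0, fun z hz => ?_⟩
  have hD : ∀ z ∈ Metric.ball (0 : ℂ) 1, HasDerivAt (fun z => E z * Complex.exp (-L z)) 0 z :=
    fun z hz => ((hE z hz).mul (hL z hz).neg.cexp).congr_deriv (by ring)
  have hconst := (convex_ball (0 : ℂ) 1).is_const_of_fderivWithin_eq_zero (𝕜 := ℂ)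
    (fun x hx => (hD x hx).differentiableAt.differentiableWithinAt) (fun x hx => by
      rw [fderivWithin_of_isOpen Metric.isOpen_ball hx]
      ext
      simp [(hD x hx).deriv]) hz (Metric.mem_ball_self one_pos)
  simp only [hE0, hL0, neg_zero, Complex.exp_zero, mul_one] at hconst
  rw [Complex.exp_neg] at hconst
  exact (div_eq_one_iff_eq (Complex.exp_ne_zero _)).1 hconst |>.symm

lemma normConst_ne_zero {a b c ν : ℝ} (hν : 0 ≤ ν) (hQ : quadQ a b c ν ≠ 0) :
    (normConst a b c ν : ℂ) ≠ 0 :=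
  Complex.ofReal_ne_zero.2 (div_ne_zero (mul_pos (Real.rpow_pos_of_pos two_pos _)
    (Real.Gamma_pos_of_pos (by positivity))).ne' hQ)

lemma besselNEntire_ne_zero {a b c ν : ℝ} (hν : 0 ≤ ν) (hQ : quadQ a b c ν ≠ 0)
    (h0 : besselNEntire a b c ν 0 = 1)
    (hzero : ∀ x : ℝ, 0 < x → besselN a b c ν (x : ℂ) = 0 → 1 < x) :
    ∀ t ∈ Icc (0 : ℝ) 1, besselNEntire a b c ν t ≠ 0 := by
  rintro t ⟨ht0, ht1⟩ hW
  rcases ht0.eq_or_lt with rfl | ht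
  · rw [Complex.ofReal_zero, h0] at hW
    exact one_ne_zero hW
  · have hs := Real.sqrt_pos.2 ht
    have hN := normConst_mul_besselN hν hQ (Complex.ofReal_mem_slitPlane.2 hs)
    rw [← Complex.ofReal_pow, Real.sq_sqrt ht0, hW, mul_zero] at hN
    have := hzero _ hs ((mul_eq_zero.1 hN).resolve_left (normConst_ne_zero hν hQ))
    exact absurd (Real.sqrt_le_one.2 ht1) (not_le.2 this)

lemma deriv_div_besselN_one {a b c ν : ℝ} (hν : 0 ≤ ν) (hQ : quadQ a b c ν ≠ 0)
    (hd : Differentiable ℂ (besselNEntire a b c ν)) (h1 : besselNEntire a b c ν 1 ≠ 0) :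
    deriv (besselN a b c ν) 1 / besselN a b c ν 1 =
      ν + 2 * (deriv (besselNEntire a b c ν) 1 / besselNEntire a b c ν 1) := by
  have hn := normConst_ne_zero (a := a) (b := b) (c := c) hν hQ
  have hN : ∀ z ∈ Complex.slitPlane, besselN a b c ν z =
      (normConst a b c ν : ℂ)⁻¹ * (z ^ (ν : ℂ) * besselNEntire a b c ν (z ^ 2)) := by
    intro z hz
    rw [← normConst_mul_besselN hν hQ hz, inv_mul_cancel_left₀ hn]
  have h2 := (mul_deriv_cpow_mul_sq hd hN Complex.one_mem_slitPlane).2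
  have h3 := hN 1 Complex.one_mem_slitPlane
  simp only [one_mul, Complex.one_cpow, one_pow] at h2 h3
  rw [h2, h3]
  field_simp

lemma normalizedG_eq {a b c ν : ℝ} (hν : 0 ≤ ν) (hQ : quadQ a b c ν ≠ 0)
    (hd : Differentiable ℂ (besselNEntire a b c ν)) :
    normalizedG a b c ν = fun z => z * besselNEntire a b c ν (z ^ 2) := by
  refine extendFrom_slitPlane (continuous_id.mul (hd.continuous.comp (continuous_pow 2))) ?_
  intro z hz
  have hz0 := Complex.slitPlane_ne_zero hz
  have hc : z ^ (ν : ℂ) ≠ 0 := by simp [Complex.cpow_eq_zero_iff, hz0]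
  change (normConst a b c ν : ℂ) * z ^ (1 - (ν : ℂ)) * besselN a b c ν z = _
  rw [mul_right_comm, normConst_mul_besselN hν hQ hz, Complex.cpow_sub _ _ hz0, Complex.cpow_one]
  field_simp

lemma normalizedH_eq {a b c ν : ℝ} (hν : 0 ≤ ν) (hQ : quadQ a b c ν ≠ 0)
    (hd : Differentiable ℂ (besselNEntire a b c ν)) :
    normalizedH a b c ν = fun z => z * besselNEntire a b c ν z := by
  refine extendFrom_slitPlane (continuous_id.mul hd.continuous) ?_
  intro z hz
  have hz0 := Complex.slitPlane_ne_zero hz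
  have hlog : (Complex.log z * (1 / 2 : ℂ)).im = z.arg / 2 := by
    have : (1 / 2 : ℂ) = ((1 / 2 : ℝ) : ℂ) := by push_cast; rfl
    rw [this, Complex.im_mul_ofReal, Complex.log_im]
    ring
  have h1 := Complex.neg_pi_lt_arg z
  have h2 := Complex.arg_le_pi z
  -- The argument of the principal root is half that of `z`, so no branch cut is crossed, neither
  -- here nor in the power law below.
  have hsqrt : z ^ (1 / 2 : ℂ) ∈ Complex.slitPlane := by
    rw [Complex.mem_slitPlane_iff_arg, Complex.cpow_def_of_ne_zero hz0, Complex.arg_exp, hlog]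
    refine ⟨?_, Complex.exp_ne_zero _⟩
    rw [toIocMod_eq_self _ |>.2 ⟨by linarith, by linarith [Real.pi_pos]⟩]
    linarith [Real.pi_pos]
  have hpow : (z ^ (1 / 2 : ℂ)) ^ (ν : ℂ) = z ^ ((ν : ℂ) / 2) := by
    rw [← Complex.cpow_mul, one_div_mul_eq_div] <;> rw [hlog] <;> linarith [Real.pi_pos]
  have hsq : (z ^ (1 / 2 : ℂ)) ^ 2 = z := by
    rw [← Complex.cpow_nat_mul]
    norm_num
  have hc : z ^ ((ν : ℂ) / 2) ≠ 0 := by simp [Complex.cpow_eq_zero_iff, hz0]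
  change (normConst a b c ν : ℂ) * z ^ (1 - (ν : ℂ) / 2) * besselN a b c ν (z ^ (1 / 2 : ℂ)) = _
  rw [mul_right_comm, normConst_mul_besselN hν hQ hsqrt, hpow, hsq, Complex.cpow_sub _ _ hz0,
    Complex.cpow_one]
  field_simp

/-- The two sides agree on the slit disk after cancelling `z ^ ν`, hence on the whole disk by
density and continuity. -/
lemma IsNormalizedF.exp_eq {a b c ν : ℝ} (hν : 0 ≤ ν) (hQ : quadQ a b c ν ≠ 0)
    (hd : Differentiable ℂ (besselNEntire a b c ν)) {L : ℂ → ℂ}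
    (hL : DifferentiableOn ℂ L (Metric.ball 0 1))
    (h : ∀ z ∈ Metric.ball (0 : ℂ) 1 ∩ Complex.slitPlane,
      (normConst a b c ν : ℂ) * besselN a b c ν z = z ^ (ν : ℂ) * Complex.exp (L z)) :
    ∀ z ∈ Metric.ball (0 : ℂ) 1, Complex.exp (L z) = besselNEntire a b c ν (z ^ 2) := by
  have heq : EqOn (fun z => Complex.exp (L z)) (fun z => besselNEntire a b c ν (z ^ 2))
      (Metric.ball (0 : ℂ) 1 ∩ Complex.slitPlane) := by
    intro z hz
    have hc : z ^ (ν : ℂ) ≠ 0 := by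
      simp [Complex.cpow_eq_zero_iff, Complex.slitPlane_ne_zero hz.2]
    have := h z hz
    rw [normConst_mul_besselN hν hQ hz.2] at this
    exact (mul_left_cancel₀ hc this).symm
  exact heq.of_subset_closure hL.continuousOn.cexp
    (hd.continuous.comp (continuous_pow 2)).continuousOn inter_subset_left
    (dense_slitPlane.open_subset_closure_inter Metric.isOpen_ball)

/-! ### The three radius conditions. -/

theorem mainTheorem5 (a b c ν β : ℝ) (φ : ℂ → ℂ)
    (habc : (c = 0 ∧ a ≠ b) ∨ (0 < c ∧ a < b))
    -- `ν ≥ max {0, ν₀}`, with `Q(ν) ≠ 0`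
    (hν : 0 ≤ ν) (hν₀ : ∀ x : ℝ, quadQ a b c x = 0 → x ≤ ν) (hQ : quadQ a b c ν ≠ 0)
    -- the smallest positive zero of `N_ν` is larger than `1`
    (hzero : ∀ x : ℝ, 0 < x → besselN a b c ν (x : ℂ) = 0 → 1 < x)
    (hφ : IsMaMinda φ)
    -- `φ(-1) = 1 - β`, as a radial limit
    (hφβ : Tendsto (fun t : ℝ => φ (t : ℂ)) (𝓝[>] (-1 : ℝ)) (𝓝 ((1 - β : ℝ) : ℂ)))
    (hβ : IsGreatest {r : ℝ | Metric.ball (1 : ℂ) r ⊆ φ '' Metric.ball 0 1} β) :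
    (ν ≠ 0 →
      1 - 1 / ν * (deriv (besselN a b c ν) 1 / besselN a b c ν 1).re < β →
        (∃ F : ℂ → ℂ, IsNormalizedF a b c ν F) ∧
          ∀ F : ℂ → ℂ, IsNormalizedF a b c ν F → IsMaMindaStarlike φ F) ∧
    (ν - (deriv (besselN a b c ν) 1 / besselN a b c ν 1).re < β →
      IsMaMindaStarlike φ (normalizedG a b c ν)) ∧
    (ν / 2 - (deriv (besselN a b c ν) 1 / (2 * besselN a b c ν 1)).re < β →
      IsMaMindaStarlike φ (normalizedH a b c ν)) := by
  have hPR := posRootedLimit_besselNEntire habc hν hν₀ hQ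
  set W := besselNEntire a b c ν with hW
  have hd : Differentiable ℂ W := hPR.differentiable
  have hW0 : W 0 = 1 := hPR.map_zero
  have hne := besselNEntire_ne_zero hν hQ hW0 hzero
  have hb : ∀ {w : ℂ}, ‖w‖ ≤ 1 → W w ≠ 0 ∧ ‖deriv W w / W w‖ ≤ -(deriv W 1 / W 1).re :=
    fun hw => hPR.norm_logDeriv_le hne hw
  set M : ℝ := -(deriv W 1 / W 1).re with hMdef
  have hN := deriv_div_besselN_one hν hQ hd (hb (w := 1) (by simp)).1
  -- This turns the three hypotheses into `2 M / ν < β`, `2 M < β` and `M < β`.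
  have hNre : (deriv (besselN a b c ν) 1 / besselN a b c ν 1).re = ν - 2 * M := by
    rw [hN, Complex.add_re, Complex.ofReal_re, hMdef, ← hW,
      ← Complex.ofReal_ofNat, Complex.re_ofReal_mul]
    ring
  have hball : ∀ {z : ℂ}, z ∈ Metric.ball (0 : ℂ) 1 → ‖z‖ ≤ 1 := fun hz =>
    (mem_ball_zero_iff.1 hz).le
  have hsq : ∀ {z : ℂ}, z ∈ Metric.ball (0 : ℂ) 1 → ‖z ^ 2‖ ≤ 1 := fun hz => by
    rw [norm_pow]
    exact pow_le_one₀ (norm_nonneg _) (hball hz)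
  have hbound : ∀ {w : ℂ}, ‖w‖ ≤ 1 → ‖w * (deriv W w / W w)‖ ≤ M := fun hw => by
    rw [norm_mul]
    exact (mul_le_of_le_one_left (norm_nonneg _) hw).trans (hb hw).2
  have hd' : Differentiable ℂ (deriv W) := hd.deriv
  -- The logarithmic derivative of `W(z²)`; the factor `2` from the chain rule is why the first two
  -- bounds carry `2 M` and the third only `M`.
  set K : ℂ → ℂ := fun z => 2 * z * (deriv W (z ^ 2) / W (z ^ 2)) with hKdef
  have hK : DifferentiableOn ℂ K (Metric.ball 0 1) := by
    refine DifferentiableOn.mul (by fun_prop) (DifferentiableOn.div ?_ ?_ fun z hz => (hb (hsq hz)).1)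
    · exact (hd'.comp (differentiable_pow 2)).differentiableOn
    · exact (hd.comp (differentiable_pow 2)).differentiableOn
  have hE : ∀ z ∈ Metric.ball (0 : ℂ) 1,
      HasDerivAt (fun z => W (z ^ 2)) (W (z ^ 2) * K z) z := fun z hz => by
    refine (HasDerivAt.comp z (hd (z ^ 2)).hasDerivAt (hasDerivAt_pow 2 z)).congr_deriv ?_
    have := (hb (hsq hz)).1
    simp only [hKdef]
    field_simp
    simp
    ring
  have hKM : ∀ z ∈ Metric.ball (0 : ℂ) 1, ‖z * K z‖ ≤ 2 * M := fun z hz => by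
    have : z * K z = 2 * (z ^ 2 * (deriv W (z ^ 2) / W (z ^ 2))) := by
      simp only [hKdef]
      ring
    rw [this, norm_mul, Complex.norm_ofNat]
    exact mul_le_mul_of_nonneg_left (hbound (hsq hz)) zero_le_two
  refine ⟨fun hν1 hlt => ⟨?_, ?_⟩, fun hlt => ?_, fun hlt => ?_⟩
  · obtain ⟨L, hLd, hL0, hL⟩ := exists_log_of_hasDerivAt hK hE (by simpa using hW0)
    refine ⟨fun z => z * Complex.exp (L z / ν), L, hLd, hL0, fun z hz => ?_, fun z _ => rfl⟩
    rw [normConst_mul_besselN hν hQ hz.2, hL z hz.1]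
  · rintro F ⟨L, hLd, hL0, hLN, hF⟩
    have hexp := IsNormalizedF.exp_eq hν hQ hd hLd hLN
    -- Differentiating `e^L = W(z²)` gives `L' = K`, so `e^{L / ν}` has logarithmic derivative `K /
    -- ν`.
    have hL' : ∀ z ∈ Metric.ball (0 : ℂ) 1, HasDerivAt L (K z) z := fun z hz => by
      have h1 := (hLd.differentiableAt (Metric.isOpen_ball.mem_nhds hz)).hasDerivAt
      have h2 := h1.cexp.unique ((hE z hz).congr_of_eventuallyEq
        (eventually_of_mem (Metric.isOpen_ball.mem_nhds hz) hexp))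
      have h3 := hexp z hz
      rw [h3] at h2
      exact mul_left_cancel₀ (hb (hsq hz)).1 h2 ▸ h1
    have hνpos : 0 < ν := lt_of_le_of_ne hν hν1.symm
    refine hφ.isMaMindaStarlike (E := fun z => Complex.exp (L z / ν)) (K := fun z => K z / ν)
      (M := 2 * M / ν) hβ.1 hF (by simp [hL0])
      (fun z hz => ((hL' z hz).div_const _).cexp) (fun z _ => Complex.exp_ne_zero _)
      (hK.div_const _) ?_ fun z hz => ?_
    · rw [hNre] at hlt
      have : 1 - 1 / ν * (ν - 2 * M) = 2 * M / ν := by field_simp; ring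
      rwa [this] at hlt
    · rw [← mul_div_assoc, norm_div, Complex.norm_of_nonneg hν]
      exact div_le_div_of_nonneg_right (hKM z hz) hν
  · rw [normalizedG_eq hν hQ hd]
    refine hφ.isMaMindaStarlike (E := fun z => W (z ^ 2)) (K := K) (M := 2 * M) hβ.1
      (fun z _ => rfl) (by simpa using hW0) hE (fun z hz => (hb (hsq hz)).1) hK ?_ hKM
    linarith
  · rw [normalizedH_eq hν hQ hd]
    refine hφ.isMaMindaStarlike (E := W) (K := fun z => deriv W z / W z) (M := M) hβ.1
      (fun z _ => rfl) hW0 (fun z hz => ?_) (fun z hz => (hb (hball hz)).1)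
      (hd'.differentiableOn.div hd.differentiableOn fun z hz => (hb (hball hz)).1) ?_
      fun z hz => hbound (hball hz)
    · exact (hd z).hasDerivAt.congr_deriv (mul_div_cancel₀ _ (hb (hball hz)).1).symm
    · have : (deriv (besselN a b c ν) 1 / (2 * besselN a b c ν 1)).re = (ν - 2 * M) / 2 := by
        rw [← hNre, mul_comm, ← div_div, ← Complex.ofReal_ofNat, Complex.div_ofReal_re]
      rw [this] at hlt
      linarith
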